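/- Let $F$ be a vector lattice (over $\mathbb{R}$). A sublattice of $F$ is a linear subspace closed under the lattice operations; $\bot$, $\sup$ and $(\cdot)^d$ taken in a sublattice $E$ refer to the induced structure of $E$. A sublattice $E$ is *regular* in $F$ if every nonempty $S\subset E$ that has a supremum in $E$ has the same supremum in $F$; it is *order dense* if for every $0<f\in F$ there is $e\in E$ with $0<e\le f$; it is an *ideal* if $0\le f\le e\in E$ implies $f\in E$; a *band* is an ideal that contains the suprema (in $F$) of all its subsets that have one. A set $G\subset F$ is *majorizing* in $F$ if no proper ideal of $F$ contains $G$. For $g\ge 0$, $F_g=\bigcup_{\alpha\ge 0}\alpha[-g,g]$ is the principal ideal of $g$. For $G\subset F$, $G^d_F=\{f\in F:\ |f|\wedge|g|=0\ \forall g\in G\}$ and $G^{dd}_F=(G^d_F)^d_F$. $F$ is *Archimedean* if $\inf_n \frac1n f=0$ for every $f\ge0$. Let $E$ be a sublattice of $F$ and consider the conditions: (i) $E$ is regular in $F$; (ii) $E\cap H$ is regular in $H$, for every ideal $H$ of $F$; (iii) there is a set $G\subset E_+$, majorizing in $E$, such that $E\cap F_g$ is regular in $F_g$ for every $g\in G$;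 (iv) $E\cap H$ is a band in $E$, for every band $H$ of $F$; (v) $G^{dd}_F\cap E=G^{dd}_E$, for every subset $G\subset E$; (v') $G^{dd}_F\cap E=G^{dd}_E$, for every ideal $G$ of $E$; (vi) there is an order dense and majorizing sublattice $H$ of $E$ that is regular in $F$. Then: 1. If $F$ is Archimedean, the conditions (i), (ii), (iii), (iv), (v), (v') and (vi) are all equivalent. 2. If $E$ is Archimedean ($F$ arbitrary), then (i)$\Leftrightarrow$(vi) and (iv)$\Rightarrow$(v). 3. For arbitrary $F$ and $E$: (i)$\Leftrightarrow$(ii)$\Leftrightarrow$(iii), (i)$\Rightarrow$(iv), and (v)$\Leftrightarrow$(v'). -/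

import Mathlib

/-- A vector sublattice of a (real) vector lattice `F`: a linear subspace that is closed under
the lattice operations of `F`. -/
structure VectorSublattice (F : Type*) [AddCommGroup F] [Lattice F] [Module ℝ F]
    extends Submodule ℝ F where
  sup_mem' : ∀ {x y : F}, x ∈ carrier → y ∈ carrier → x ⊔ y ∈ carrier
  inf_mem' : ∀ {x y : F}, x ∈ carrier → y ∈ carrier → x ⊓ y ∈ carrier

/-- The disjoint complement `G ᵈ` of a subset `G` of a vector lattice, computed in that lattice. -/
def disjCompl {F : Type*} [AddCommGroup F] [Lattice F] (G : Set F) : Set F :=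
  {f | ∀ g ∈ G, |f| ⊓ |g| = 0}

/-- A vector lattice is Archimedean if `(1 / n) f ↓ 0` for every `f ≥ 0`. -/
def IsArchimedeanVL (F : Type*) [AddCommGroup F] [Lattice F] [Module ℝ F] : Prop :=
  ∀ f : F, 0 ≤ f → IsGLB (Set.range fun n : ℕ => (1 / ((n : ℝ) + 1)) • f) 0

namespace VectorSublattice

section Instances

variable {F : Type*} [AddCommGroup F] [Lattice F] [Module ℝ F]

instance : SetLike (VectorSublattice F) F where
  coe E := E.carrier
  coe_injective E H h := by
    cases E; cases H; congr; exact SetLike.coe_injective h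

instance : AddSubgroupClass (VectorSublattice F) F where
  add_mem {E} := E.add_mem'
  zero_mem E := E.zero_mem'
  neg_mem {E} {_} hx := E.toSubmodule.neg_mem hx

instance : SMulMemClass (VectorSublattice F) ℝ F where
  smul_mem {E} c _ hx := E.smul_mem' c hx

/-- A vector sublattice is a lattice in the order and with the operations of `F`. -/
instance (E : VectorSublattice F) : Lattice E :=
  Subtype.lattice (fun {_ _} hx hy => E.sup_mem' hx hy) (fun {_ _} hx hy => E.inf_mem' hx hy)

instance [IsOrderedAddMonoid F] (E : VectorSublattice F) : IsOrderedAddMonoid E where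
  add_le_add_left a b h c :=
    show (a : F) + c ≤ b + c from add_le_add_left (show (a : F) ≤ b from h) (c : F)

instance [PosSMulMono ℝ F] (E : VectorSublattice F) : PosSMulMono ℝ E where
  smul_le_smul_of_nonneg_left a ha b c h :=
    show a • (b : F) ≤ a • (c : F) from
      smul_le_smul_of_nonneg_left (show (b : F) ≤ c from h) ha

end Instances

section Defs

variable {F : Type*} [AddCommGroup F] [Lattice F] [Module ℝ F]

/-- `E.inside H` is the intersection `E ∩ H`, regarded as a sublattice of the vector lattice `H`. -/
def inside (E H : VectorSublattice F) : VectorSublattice H where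
  carrier := {x | (x : F) ∈ E}
  add_mem' hx hy := add_mem (S := VectorSublattice F) (s := E) hx hy
  zero_mem' := zero_mem E
  smul_mem' c _ hx := SMulMemClass.smul_mem (s := E) c hx
  sup_mem' hx hy := E.sup_mem' hx hy
  inf_mem' hx hy := E.inf_mem' hx hy

/-- `E` is a regular sublattice of `F`: whenever a (nonempty) subset `S` of `E` has a supremum
in `E`, this is also its supremum in `F`. -/
def IsRegular (E : VectorSublattice F) : Prop :=
  ∀ (S : Set E) (s : E), S.Nonempty → IsLUB S s → IsLUB ((fun x : E => (x : F)) '' S) (s : F)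

/-- `E` is order dense in `F`. -/
def IsOrderDense (E : VectorSublattice F) : Prop :=
  ∀ f : F, 0 < f → ∃ e ∈ E, 0 < e ∧ e ≤ f

/-- A sublattice `I` of `F` is an (order) ideal of `F`. -/
def IsIdeal (I : VectorSublattice F) : Prop :=
  ∀ f e : F, 0 ≤ f → f ≤ e → e ∈ I → f ∈ I

/-- A band is an ideal that contains the suprema, taken in `F`, of all its subsets that have
one. -/
def IsBand (B : VectorSublattice F) : Prop :=
  B.IsIdeal ∧ ∀ (S : Set F) (s : F), S ⊆ B → IsLUB S s → s ∈ B

/-- A subset `G` of `F` is majorizing in `F` if no proper ideal of `F` contains it. -/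
def IsMajorizing (G : Set F) : Prop :=
  ∀ I : VectorSublattice F, I.IsIdeal → G ⊆ I → ∀ f : F, f ∈ I

/-- The principal ideal `F_g` of `F`. For `g ≥ 0` it is the union of the `α [-g, g]`, `α ≥ 0`. -/
def principalIdeal [IsOrderedAddMonoid F] [PosSMulMono ℝ F] (g : F) : VectorSublattice F where
  carrier := {f | ∃ α : ℝ, 0 ≤ α ∧ |f| ≤ α • |g|}
  add_mem' := by
    rintro x y ⟨a, ha, hx⟩ ⟨b, hb, hy⟩
    refine ⟨a + b, add_nonneg ha hb, (abs_add_le x y).trans ?_⟩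
    rw [add_smul]
    exact add_le_add hx hy
  zero_mem' := ⟨0, le_rfl, by simp⟩
  smul_mem' := by
    rintro c x ⟨a, ha, hx⟩
    refine ⟨|c| * a, mul_nonneg (abs_nonneg c) ha, ?_⟩
    have h1 : |c| • |x| ≤ (|c| * a) • |g| := by
      rw [mul_smul]
      exact smul_le_smul_of_nonneg_left hx (abs_nonneg c)
    refine le_trans ?_ h1
    have h2 : ∀ d : ℝ, ∀ z : F, 0 ≤ d → |d • z| ≤ d • |z| := fun d z hd =>
      abs_le'.2 ⟨smul_le_smul_of_nonneg_left (le_abs_self z) hd, by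
        rw [← smul_neg]; exact smul_le_smul_of_nonneg_left (neg_le_abs z) hd⟩
    rcases le_total 0 c with hc | hc
    · rw [abs_of_nonneg hc]; exact h2 c x hc
    · rw [abs_of_nonpos hc, ← abs_neg, ← neg_smul]; exact h2 (-c) x (neg_nonneg.2 hc)
  sup_mem' := by
    rintro x y ⟨a, ha, hx⟩ ⟨b, hb, hy⟩
    refine ⟨a + b, add_nonneg ha hb, ?_⟩
    rw [add_smul]
    have hx' := hx.trans (le_add_of_nonneg_right ((abs_nonneg y).trans hy))
    have hy' := hy.trans (le_add_of_nonneg_left ((abs_nonneg x).trans hx))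
    refine abs_le'.2 ⟨sup_le ((le_abs_self x).trans hx') ((le_abs_self y).trans hy'), ?_⟩
    exact (neg_le_neg le_sup_left).trans ((neg_le_abs x).trans hx')
  inf_mem' := by
    rintro x y ⟨a, ha, hx⟩ ⟨b, hb, hy⟩
    refine ⟨a + b, add_nonneg ha hb, ?_⟩
    rw [add_smul]
    have hx' := hx.trans (le_add_of_nonneg_right ((abs_nonneg y).trans hy))
    have hy' := hy.trans (le_add_of_nonneg_left ((abs_nonneg x).trans hx))
    refine abs_le'.2 ⟨inf_le_left.trans ((le_abs_self x).trans hx'), ?_⟩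
    rw [neg_inf]
    exact sup_le ((neg_le_abs x).trans hx') ((neg_le_abs y).trans hy')

/-- `E ∩ H` is regular in `H`, for every ideal `H` of `F`. -/
def RegularInIdeals (E : VectorSublattice F) : Prop :=
  ∀ H : VectorSublattice F, H.IsIdeal → (E.inside H).IsRegular

/-- There is a set `G` of positive elements of `E`, majorizing in `E`, such that `E ∩ F_g` is
regular in `F_g` for every `g ∈ G`. -/
def RegularInMajorizingIdeals [IsOrderedAddMonoid F] [PosSMulMono ℝ F]
    (E : VectorSublattice F) : Prop :=
  ∃ G : Set E, (∀ g ∈ G, 0 ≤ g) ∧ IsMajorizing G ∧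
    ∀ g ∈ G, (E.inside (principalIdeal (g : F))).IsRegular

/-- `E ∩ H` is a band in `E`, for every band `H` of `F`. -/
def MeetsBandsInBands (E : VectorSublattice F) : Prop :=
  ∀ H : VectorSublattice F, H.IsBand → (H.inside E).IsBand

/-- For a subset `G` of `E`: the trace on `E` of the second disjoint complement of `G` in `F` is
the second disjoint complement of `G` in `E`. -/
def DoubleComplAgrees (E : VectorSublattice F) (G : Set E) : Prop :=
  {x : E | (x : F) ∈ disjCompl (disjCompl ((fun y : E => (y : F)) '' G))} =
    disjCompl (disjCompl G)

/-- There is an order dense and majorizing sublattice `H` of `E` that is regular in `F`. -/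
def HasRegularDenseMajorizing (E : VectorSublattice F) : Prop :=
  ∃ H : VectorSublattice F, (∀ x ∈ H, x ∈ E) ∧
    (H.inside E).IsOrderDense ∧ IsMajorizing (H.inside E : Set E) ∧ H.IsRegular

end Defs

end VectorSublattice

/-!
Everything rests on reformulating regularity at zero: `E` is regular in `F` iff a nonempty `D ⊆ E`
with infimum `0` in `E` has no nonzero lower bound `v ≥ 0` in `F` (`isRegular_iff`).

* Passing to ideals costs nothing, because for `D ≥ 0` positive lower bounds stay in every ideal
  that meets `D`. Conversely, if `E ∩ F_g` is regular in `F_g`, then the lower bound `v` is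
  disjoint from `g`, as seen from the set of all `d ⊓ g`. The elements of `E` disjoint from `v`
  form an ideal of `E`, which contains the majorizing set and hence all of `E`; so `v` is disjoint
  from any `d ≥ v`, and `v = 0`.
* Disjoint complements are bands (`isBand_disjCompl`). Replacing `G` by the ideal
  `Gᵈᵈ ∩ E` of `E` changes neither of the complements of `G`, so the condition on double complements
  need only be tested on ideals.
* In an Archimedean vector lattice, an element `x ≥ 0` is the supremum of those elements of a
  sublattice `H` that lie in `[0, x]`, as soon as `H` meets every `(0, w]` with `0 < w ≤ x`
  (`isLUB_of_order_dense_below`). This gives that regularity passes from an order dense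
  majorizing sublattice to the whole of `E`, and also that a band `B` equals `Bᵈᵈ`
  (`IsBand.disjCompl_disjCompl_subset`).
* If `F` is Archimedean and double complements agree, let `D` and `v` be as above, let `d₀ ∈ D` and
  `e = d₀ / (n + 1)`. In `E`, every `f` disjoint from all `(e - d)⁺` satisfies `|f| ⊓ e ≤ d` for all
  `d ∈ D`, so `e` lies in the double complement in `E` of `{(e - d)⁺ | d ∈ D}`, thus also in the
  one in `F`. But `(v - e)⁺ ≤ (e - d)⁻` is disjoint from that set, so it is disjoint from `e` and
  from `d₀ ≥ (v - e)⁺`; hence `v ≤ d₀ / (n + 1)` for all `n`, and `v = 0`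
  (`isRegular_of_doubleComplAgrees`).
-/

/-! ### Disjointness in lattice ordered groups -/

section LatticeOrderedGroup

variable {F : Type*} [AddCommGroup F] [Lattice F]

theorem inf_eq_zero_of_le_of_le {a b a' b' : F} (ha : 0 ≤ a) (hb : 0 ≤ b) (haa : a ≤ a')
    (hbb : b ≤ b') (h : a' ⊓ b' = 0) : a ⊓ b = 0 :=
  le_antisymm ((inf_le_inf haa hbb).trans h.le) (le_inf ha hb)

theorem disjCompl_antitone {G H : Set F} (h : G ⊆ H) : disjCompl H ⊆ disjCompl G :=
  fun _ hf g hg => hf g (h hg)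

theorem subset_disjCompl_disjCompl (G : Set F) : G ⊆ disjCompl (disjCompl G) :=
  fun g hg f hf => by rw [inf_comm]; exact hf g hg

variable [IsOrderedAddMonoid F]

theorem inf_add_le_inf_add_inf {a b c : F} (ha : 0 ≤ a) (hb : 0 ≤ b) (hc : 0 ≤ c) :
    a ⊓ (b + c) ≤ a ⊓ b + a ⊓ c := by
  rw [add_inf, inf_add, inf_add]
  refine le_inf (le_inf ?_ ?_) (le_inf ?_ inf_le_right)
  · exact inf_le_left.trans (le_add_of_nonneg_right ha)
  · exact inf_le_left.trans (le_add_of_nonneg_left hb)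
  · exact inf_le_left.trans (le_add_of_nonneg_right hc)

theorem disjCompl_of_abs_le {G : Set F} {x y : F} (h : |x| ≤ |y|) (hy : y ∈ disjCompl G) :
    x ∈ disjCompl G := fun g hg =>
  inf_eq_zero_of_le_of_le (abs_nonneg x) (abs_nonneg g) h le_rfl (hy g hg)

theorem add_mem_disjCompl {G : Set F} {x y : F} (hx : x ∈ disjCompl G) (hy : y ∈ disjCompl G) :
    x + y ∈ disjCompl G := by
  intro g hg
  refine le_antisymm ?_ (le_inf (abs_nonneg _) (abs_nonneg _))
  calc |x + y| ⊓ |g| ≤ |g| ⊓ (|x| + |y|) := by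
        rw [inf_comm]; exact inf_le_inf_left _ (abs_add_le x y)
    _ ≤ |g| ⊓ |x| + |g| ⊓ |y| :=
        inf_add_le_inf_add_inf (abs_nonneg g) (abs_nonneg x) (abs_nonneg y)
    _ = 0 := by rw [inf_comm, hx g hg, inf_comm, hy g hg, add_zero]

theorem posPart_le_abs_self (x : F) : x⁺ ≤ |x| := sup_le (le_abs_self x) (abs_nonneg x)

theorem negPart_le_abs_self (x : F) : x⁻ ≤ |x| := sup_le (neg_le_abs x) (abs_nonneg x)

/-- A least element is `0`. This disposes of the empty set, which the definition of a band allows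
and that of regularity does not. -/
theorem eq_zero_of_isLUB_empty {s : F} (hs : IsLUB (∅ : Set F) s) : s = 0 := by
  have h : ∀ u, s ≤ u := fun u => hs.2 fun x hx => hx.elim
  have h0 : 0 ≤ s := by simpa using h (s + s)
  exact le_antisymm (h 0) h0

end LatticeOrderedGroup

/-! ### Sublattices of vector lattices -/

namespace VectorSublattice

variable {F : Type*} [AddCommGroup F] [Lattice F] [Module ℝ F]

theorem posPart_mem (E : VectorSublattice F) {x : F} (hx : x ∈ E) : x⁺ ∈ E :=
  E.sup_mem' hx (zero_mem E)

theorem abs_mem (E : VectorSublattice F) {x : F} (hx : x ∈ E) : |x| ∈ E :=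
  E.sup_mem' hx (neg_mem hx)

/-- Disjointness of elements of a sublattice does not depend on the lattice in which it is
computed. -/
theorem coe_mem_disjCompl_iff {E : VectorSublattice F} {G : Set E} {x : E} :
    (x : F) ∈ disjCompl ((fun y : E => (y : F)) '' G) ↔ x ∈ disjCompl G := by
  constructor
  · intro h g hg
    exact Subtype.ext (h g ⟨g, hg, rfl⟩)
  · rintro h _ ⟨g, hg, rfl⟩
    exact congrArg Subtype.val (h g hg)

theorem IsIdeal.inside {H : VectorSublattice F} (hH : H.IsIdeal) (E : VectorSublattice F) :
    (H.inside E).IsIdeal := fun f e hf hfe he => hH f e hf hfe he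

/-- The trace on `E` of the double complement in `F` is always contained in the one taken
in `E`. -/
theorem mem_disjCompl_disjCompl_of_coe {E : VectorSublattice F} {G : Set E} {x : E}
    (hx : (x : F) ∈ disjCompl (disjCompl ((fun y : E => (y : F)) '' G))) :
    x ∈ disjCompl (disjCompl G) := fun f hf =>
  Subtype.ext (hx f (coe_mem_disjCompl_iff.2 hf))

theorem eq_zero_of_forall_le_smul (hF : IsArchimedeanVL F) {v x : F} (hv : 0 ≤ v) (hx : 0 ≤ x)
    (h : ∀ n : ℕ, v ≤ (1 / ((n : ℝ) + 1)) • x) : v = 0 := by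
  refine le_antisymm ((hF x hx).2 ?_) hv
  rintro _ ⟨n, rfl⟩
  exact h n

theorem isArchimedeanVL_coe (hF : IsArchimedeanVL F) (E : VectorSublattice F) :
    IsArchimedeanVL E := by
  intro f hf
  have h := hF f hf
  refine ⟨?_, fun z hz => h.2 ?_⟩
  · rintro _ ⟨n, rfl⟩
    exact h.1 ⟨n, rfl⟩
  · rintro _ ⟨n, rfl⟩
    exact hz ⟨n, rfl⟩

theorem IsRegular.hasRegularDenseMajorizing {E : VectorSublattice F} (h : E.IsRegular) :
    E.HasRegularDenseMajorizing :=
  ⟨E, fun _ hx => hx, fun f hf => ⟨f, f.2, hf, le_rfl⟩, fun _ _ hI f => hI f.2, h⟩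

theorem abs_smul_le [PosSMulMono ℝ F] (c : ℝ) (x : F) : |c • x| ≤ |c| • |x| := by
  have h : ∀ d : ℝ, ∀ z : F, 0 ≤ d → |d • z| ≤ d • |z| := fun d z hd =>
    abs_le'.2 ⟨smul_le_smul_of_nonneg_left (le_abs_self z) hd, by
      rw [← smul_neg]; exact smul_le_smul_of_nonneg_left (neg_le_abs z) hd⟩
  rcases le_total 0 c with hc | hc
  · rw [abs_of_nonneg hc]; exact h c x hc
  · rw [abs_of_nonpos hc, ← abs_neg, ← neg_smul]; exact h (-c) x (neg_nonneg.2 hc)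

variable [IsOrderedAddMonoid F]

/-! ### Ideals, bands and disjoint complements -/

theorem IsIdeal.mem_of_abs_le {I : VectorSublattice F} (hI : I.IsIdeal) {x e : F}
    (hx : |x| ≤ e) (he : e ∈ I) : x ∈ I := by
  rw [← posPart_sub_negPart x]
  exact sub_mem (hI _ _ (posPart_nonneg x) ((posPart_le_abs_self x).trans hx) he)
    (hI _ _ (negPart_nonneg x) ((negPart_le_abs_self x).trans hx) he)

/-- A solid linear subspace, as a sublattice. -/
def ofSolid (I : Submodule ℝ F) (hI : ∀ x y : F, |x| ≤ |y| → y ∈ I → x ∈ I) :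
    VectorSublattice F where
  toSubmodule := I
  sup_mem' {x y} hx hy := by
    have h : |x| + |y| ∈ I :=
      I.add_mem (hI _ x (abs_abs x).le hx) (hI _ y (abs_abs y).le hy)
    refine hI _ _ ?_ h
    rw [abs_of_nonneg (add_nonneg (abs_nonneg x) (abs_nonneg y))]
    refine abs_le'.2 ⟨sup_le ?_ ?_, ?_⟩
    · exact (le_abs_self x).trans (le_add_of_nonneg_right (abs_nonneg y))
    · exact (le_abs_self y).trans (le_add_of_nonneg_left (abs_nonneg x))
    · exact (neg_le_neg le_sup_left).trans
        ((neg_le_abs x).trans (le_add_of_nonneg_right (abs_nonneg y)))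
  inf_mem' {x y} hx hy := by
    have h : |x| + |y| ∈ I :=
      I.add_mem (hI _ x (abs_abs x).le hx) (hI _ y (abs_abs y).le hy)
    refine hI _ _ ?_ h
    rw [abs_of_nonneg (add_nonneg (abs_nonneg x) (abs_nonneg y))]
    refine abs_le'.2 ⟨?_, ?_⟩
    · exact inf_le_left.trans ((le_abs_self x).trans (le_add_of_nonneg_right (abs_nonneg y)))
    · rw [neg_inf]
      exact sup_le ((neg_le_abs x).trans (le_add_of_nonneg_right (abs_nonneg y)))
        ((neg_le_abs y).trans (le_add_of_nonneg_left (abs_nonneg x)))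

theorem isIdeal_ofSolid (I : Submodule ℝ F) (hI : ∀ x y : F, |x| ≤ |y| → y ∈ I → x ∈ I) :
    (ofSolid I hI).IsIdeal := fun f e hf hfe he =>
  hI f e (by rwa [abs_of_nonneg hf, abs_of_nonneg (hf.trans hfe)]) he

section DisjointComplement

variable [PosSMulMono ℝ F]

theorem smul_le_smul_of_le_of_nonneg {a b : ℝ} (hab : a ≤ b) {x : F} (hx : 0 ≤ x) :
    a • x ≤ b • x := by
  rw [← sub_nonneg, ← sub_smul]
  simpa using smul_le_smul_of_nonneg_left hx (sub_nonneg.2 hab)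

theorem smul_mem_disjCompl {G : Set F} (c : ℝ) {x : F} (hx : x ∈ disjCompl G) :
    c • x ∈ disjCompl G := by
  obtain ⟨n, hn⟩ := exists_nat_ge |c|
  have hnx : (n : ℝ) • |x| ∈ disjCompl G := by
    clear hn
    induction n with
    | zero => intro g _; simp
    | succ k ih =>
      rw [Nat.cast_succ, add_smul, one_smul]
      exact add_mem_disjCompl ih (disjCompl_of_abs_le (abs_abs x).le hx)
  refine disjCompl_of_abs_le ?_ hnx
  exact ((abs_smul_le c x).trans (smul_le_smul_of_le_of_nonneg hn (abs_nonneg x))).trans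
    (le_abs_self _)

/-- The disjoint complement of a set, as a sublattice. -/
def disjComplement (G : Set F) : VectorSublattice F :=
  ofSolid
    { carrier := disjCompl G
      add_mem' := add_mem_disjCompl
      zero_mem' := fun g _ => by simp
      smul_mem' := fun c _ hx => smul_mem_disjCompl c hx }
    fun _ _ h hy => disjCompl_of_abs_le h hy

theorem isIdeal_disjComplement (G : Set F) : (disjComplement G).IsIdeal := isIdeal_ofSolid _ _

theorem isBand_disjCompl (G : Set F) : (disjComplement G).IsBand := by
  refine ⟨isIdeal_disjComplement G, fun S s hS hs => ?_⟩
  rcases S.eq_empty_or_nonempty with rfl | ⟨x₀, hx₀⟩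
  · rw [eq_zero_of_isLUB_empty hs]; exact zero_mem _
  have hs₀ : x₀ ≤ s := hs.1 hx₀
  have key : s - x₀ ∈ disjComplement G := by
    intro g hg
    rw [abs_of_nonneg (sub_nonneg.2 hs₀)]
    set p := (s - x₀) ⊓ |g|
    have hp : 0 ≤ p := le_inf (sub_nonneg.2 hs₀) (abs_nonneg g)
    -- Each `(x - x₀)⁺` is disjoint from `p`, so their sum is their supremum, which is `≤ s - x₀`.
    have hub : s ≤ s - p := hs.2 fun x hx => by
      have hd : (x - x₀)⁺ ⊓ p = 0 := by
        have hm : (x - x₀)⁺ ∈ disjComplement G :=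
          posPart_mem _ (sub_mem (hS hx) (hS hx₀))
        have := hm g hg
        rw [abs_of_nonneg (posPart_nonneg _)] at this
        exact inf_eq_zero_of_le_of_le (posPart_nonneg _) hp le_rfl inf_le_right this
      have hsum : (x - x₀)⁺ + p ≤ s - x₀ := by
        rw [← inf_add_sup, hd, zero_add]
        exact sup_le (sup_le (sub_le_sub_right (hs.1 hx) _) (sub_nonneg.2 hs₀)) inf_le_left
      rw [le_sub_iff_add_le]
      have h := add_le_add_left ((add_le_add_left (le_posPart (x - x₀)) p).trans hsum) x₀
      rw [sub_add_cancel] at h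
      convert h using 1
      abel
    exact le_antisymm (by simpa using hub) hp
  rw [← sub_add_cancel s x₀]
  exact add_mem key (hS hx₀)

end DisjointComplement

/-! ### Regularity -/

/-- Regularity, tested on the sets with infimum `0`. -/
theorem isRegular_iff {E : VectorSublattice F} : E.IsRegular ↔
    ∀ D : Set E, D.Nonempty → IsGLB D 0 → ∀ v : F, 0 ≤ v → (∀ d ∈ D, v ≤ (d : F)) → v = 0 := by
  constructor
  · intro h D hne hD v hv hvD
    have hlub : IsLUB (-D) (0 : E) := by
      simpa using hD.neg
    have := (h (-D) 0 hne.neg hlub).2 (show -v ∈ upperBounds _ by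
      rintro _ ⟨x, hx, rfl⟩
      exact le_neg_of_le_neg (hvD _ hx))
    exact le_antisymm (neg_nonneg.1 this) hv
  · intro h S s hne hS
    refine ⟨?_, fun u hu => ?_⟩
    · rintro _ ⟨x, hx, rfl⟩
      exact hS.1 hx
    have hglb : IsGLB ((fun x : E => s - x) '' S) 0 := by
      refine ⟨?_, fun z hz => ?_⟩
      · rintro _ ⟨x, hx, rfl⟩
        exact sub_nonneg.2 (hS.1 hx)
      · have : s ≤ s - z := hS.2 fun x hx => le_sub_comm.1 (hz ⟨x, hx, rfl⟩)
        simpa using this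
    have h0 := h _ (hne.image _) hglb ((s : F) - u)⁺ (posPart_nonneg _) (by
      rintro _ ⟨x, hx, rfl⟩
      exact sup_le (sub_le_sub_left (hu ⟨x, hx, rfl⟩) _)
        (sub_nonneg.2 (show (x : F) ≤ s from hS.1 hx)))
    exact sub_nonpos.1 (posPart_eq_zero.1 h0)

theorem IsRegular.regularInIdeals {E : VectorSublattice F} (h : E.IsRegular) :
    E.RegularInIdeals := by
  intro H hH
  rw [isRegular_iff] at h ⊢
  intro D hne hD v hv hvD
  have hglb : IsGLB ((fun d : E.inside H => (⟨((d : H) : F), d.2⟩ : E)) '' D) 0 := by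
    refine ⟨?_, fun z hz => ?_⟩
    · rintro _ ⟨d, hd, rfl⟩
      exact hD.1 hd
    · have hle : ∀ d ∈ D, (z : F)⁺ ≤ ((d : H) : F) := fun d hd =>
        sup_le (hz ⟨d, hd, rfl⟩) (hD.1 hd)
      obtain ⟨d, hd⟩ := hne
      have hzH : (z : F)⁺ ∈ H := hH _ _ (posPart_nonneg _) (hle d hd) (d : H).2
      have hz0 : (⟨⟨(z : F)⁺, hzH⟩, E.posPart_mem z.2⟩ : E.inside H) ≤ 0 :=
        hD.2 fun d hd => hle d hd
      exact (le_posPart (z : F)).trans hz0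
  refine Subtype.ext (h _ (hne.image _) hglb (v : F) hv ?_)
  rintro _ ⟨d, hd, rfl⟩
  exact hvD d hd

theorem RegularInIdeals.regularInMajorizingIdeals [PosSMulMono ℝ F] {E : VectorSublattice F}
    (h : E.RegularInIdeals) : E.RegularInMajorizingIdeals := by
  refine ⟨{g | 0 ≤ g}, fun g hg => hg, fun I hI hG f => ?_, fun g _ => h _ ?_⟩
  · exact hI.mem_of_abs_le le_rfl (hG (abs_nonneg f))
  · rintro f e hf hfe ⟨α, hα, he⟩
    exact ⟨α, hα, by rw [abs_of_nonneg hf]; exact (hfe.trans (le_abs_self e)).trans he⟩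

theorem RegularInMajorizingIdeals.isRegular [PosSMulMono ℝ F] {E : VectorSublattice F}
    (h : E.RegularInMajorizingIdeals) : E.IsRegular := by
  obtain ⟨G, hG0, hG, hreg⟩ := h
  rw [isRegular_iff]
  intro D hne hD v hv hvD
  -- The elements of `E` disjoint from `v` form an ideal of `E`; it contains `G`, so it is `E`.
  have hmem : ∀ f : E, f ∈ (disjComplement {v}).inside E := by
    refine hG _ ((isIdeal_disjComplement {v}).inside E) fun g hg => ?_
    intro w hw
    rw [Set.mem_singleton_iff.1 hw]
    have hg0 : 0 ≤ (g : F) := hG0 g hg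
    rw [abs_of_nonneg hv, abs_of_nonneg hg0]
    have hP : ∀ x : F, 0 ≤ x → x ≤ g → x ∈ principalIdeal (g : F) := fun x hx hxg =>
      ⟨1, zero_le_one, by rwa [one_smul, abs_of_nonneg hx, abs_of_nonneg hg0]⟩
    have hd0 : ∀ d ∈ D, 0 ≤ (d : F) := fun d hd => hD.1 hd
    let D' : Set (E.inside (principalIdeal (g : F))) :=
      {y | ∃ d ∈ D, ((y : principalIdeal (g : F)) : F) = (d : F) ⊓ g}
    have hglb : IsGLB D' 0 := by
      refine ⟨?_, fun z hz => ?_⟩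
      · rintro y ⟨d, hd, hy⟩
        show (0 : F) ≤ ((y : principalIdeal (g : F)) : F)
        rw [hy]
        exact le_inf (hd0 d hd) hg0
      · refine hD.2 (show (⟨((z : principalIdeal (g : F)) : F), z.2⟩ : E) ∈ lowerBounds D from
          fun d hd => ?_)
        have hzd := mem_lowerBounds.1 hz ⟨⟨(d : F) ⊓ g, hP _ (le_inf (hd0 d hd) hg0) inf_le_right⟩,
          E.inf_mem' d.2 g.2⟩ ⟨d, hd, rfl⟩
        exact le_trans (b := (d : F) ⊓ g) hzd inf_le_left
    obtain ⟨d, hd⟩ := hne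
    have hne' : D'.Nonempty :=
      ⟨⟨⟨(d : F) ⊓ g, hP _ (le_inf (hd0 d hd) hg0) inf_le_right⟩, E.inf_mem' d.2 g.2⟩, d, hd, rfl⟩
    have h0 := isRegular_iff.1 (hreg g hg) D' hne' hglb
      ⟨(g : F) ⊓ v, hP _ (le_inf hg0 hv) inf_le_left⟩ (le_inf hg0 hv) (by
        rintro y ⟨d', hd', hy⟩
        show (g : F) ⊓ v ≤ ((y : principalIdeal (g : F)) : F)
        rw [hy, inf_comm]
        exact inf_le_inf_right _ (hvD d' hd'))
    exact congrArg Subtype.val h0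
  obtain ⟨d, hd⟩ := hne
  have h0 : |(d : F)| ⊓ |v| = 0 := hmem d v rfl
  rwa [abs_of_nonneg hv, inf_eq_right.2 ((hvD d hd).trans (le_abs_self _))] at h0

theorem IsRegular.meetsBandsInBands [PosSMulMono ℝ F] {E : VectorSublattice F}
    (h : E.IsRegular) : E.MeetsBandsInBands := by
  refine fun H hH => ⟨hH.1.inside E, fun S s hS hs => ?_⟩
  rcases S.eq_empty_or_nonempty with rfl | hne
  · rw [eq_zero_of_isLUB_empty hs]; exact zero_mem _
  · refine hH.2 _ _ ?_ (h S s hne hs)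
    rintro _ ⟨x, hx, rfl⟩
    exact hS hx

/-! ### Double complements -/

/-- The ideal `Gᵈᵈ ∩ E` of `E` has the same disjoint complements as `G`, both in `F` and in `E`. -/
theorem doubleComplAgrees_of_isIdeal [PosSMulMono ℝ F] {E : VectorSublattice F}
    (h : ∀ G : VectorSublattice E, G.IsIdeal → E.DoubleComplAgrees (G : Set E)) (G : Set E) :
    E.DoubleComplAgrees G := by
  set G' : Set F := (fun y : E => (y : F)) '' G
  set I : VectorSublattice E := (disjComplement (disjCompl G')).inside E
  have hGI : G ⊆ I := fun g hg => subset_disjCompl_disjCompl G' ⟨g, hg, rfl⟩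
  have hF : disjCompl ((fun y : E => (y : F)) '' (I : Set E)) = disjCompl G' := by
    refine (disjCompl_antitone (Set.image_mono hGI)).antisymm ?_
    refine (subset_disjCompl_disjCompl (disjCompl G')).trans (disjCompl_antitone ?_)
    rintro _ ⟨x, hx, rfl⟩
    exact hx
  have hE : disjCompl (I : Set E) = disjCompl G := by
    ext x
    rw [← coe_mem_disjCompl_iff, hF, coe_mem_disjCompl_iff]
  have hI := h I ((isIdeal_disjComplement _).inside E)
  rwa [DoubleComplAgrees, hF, hE] at hI

/-! ### Archimedean vector lattices -/

/-- In an Archimedean vector lattice, an element is approximated from below by any sublattice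
that is order dense below it. -/
theorem isLUB_of_order_dense_below [PosSMulMono ℝ F] (hF : IsArchimedeanVL F)
    {H : VectorSublattice F} {x : F} (hx : 0 ≤ x)
    (hH : ∀ w : F, 0 < w → w ≤ x → ∃ h ∈ H, 0 < h ∧ h ≤ w) :
    IsLUB {h : F | h ∈ H ∧ 0 ≤ h ∧ h ≤ x} x := by
  refine ⟨fun h hh => hh.2.2, fun u hu => ?_⟩
  by_contra hxu
  have hu0 : 0 ≤ u := hu ⟨zero_mem H, le_rfl, hx⟩
  have hw : 0 < x - x ⊓ u :=
    sub_pos.2 (lt_of_le_of_ne inf_le_left fun h => hxu (inf_eq_left.1 h))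
  obtain ⟨h, hhH, hh0, hhw⟩ := hH _ hw (sub_le_self _ (le_inf hx hu0))
  -- Each multiple of `h` below `x` lies in `H`, hence also below `u`; so one can add `h` to it.
  have hn : ∀ n : ℕ, (n : ℝ) • h ≤ x := by
    intro n
    induction n with
    | zero => simpa using hx
    | succ k ih =>
      have hk0 : 0 ≤ (k : ℝ) • h := smul_nonneg (Nat.cast_nonneg k) hh0.le
      have hku : (k : ℝ) • h ≤ u := hu ⟨SMulMemClass.smul_mem _ hhH, hk0, ih⟩
      rw [Nat.cast_succ, add_smul, one_smul]
      calc (k : ℝ) • h + h ≤ x ⊓ u + (x - x ⊓ u) := add_le_add (le_inf ih hku) hhw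
        _ = x := by abel
  refine hh0.ne' (eq_zero_of_forall_le_smul hF hh0.le hx fun n => ?_)
  have hpos : (0 : ℝ) < (n : ℝ) + 1 := by positivity
  have := smul_le_smul_of_nonneg_left (hn (n + 1)) (one_div_pos.2 hpos).le
  rwa [smul_smul, Nat.cast_succ, one_div_mul_cancel hpos.ne', one_smul] at this

/-- In an Archimedean vector lattice, a band is its own double complement. -/
theorem IsBand.disjCompl_disjCompl_subset [PosSMulMono ℝ F] (hF : IsArchimedeanVL F)
    {B : VectorSublattice F} (hB : B.IsBand) :
    disjCompl (disjCompl (B : Set F)) ⊆ (B : Set F) := by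
  intro x hx
  refine hB.1.mem_of_abs_le le_rfl ?_
  refine hB.2 _ _ (fun h hh => hh.1)
    (isLUB_of_order_dense_below hF (H := B) (abs_nonneg x) fun w hw hwx => ?_)
  -- If `B` had no element in `(0, w]`, then `w` would be disjoint from `B` and from `|x| ≥ w`.
  by_contra! hcon
  have hwB : w ∈ disjCompl (B : Set F) := by
    intro b hb
    by_contra hne
    rw [abs_of_pos hw] at hne
    have h0 : 0 ≤ w ⊓ |b| := le_inf hw.le (abs_nonneg b)
    exact hcon _ (hB.1 _ _ h0 inf_le_right (B.abs_mem hb))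
      (lt_of_le_of_ne h0 (Ne.symm hne)) inf_le_left
  have h0 := hx w hwB
  rw [abs_of_pos hw, inf_eq_right.2 hwx] at h0
  exact hw.ne' h0

theorem MeetsBandsInBands.doubleComplAgrees [PosSMulMono ℝ F] {E : VectorSublattice F}
    (hE : IsArchimedeanVL E) (h : E.MeetsBandsInBands) (G : Set E) : E.DoubleComplAgrees G := by
  refine Set.Subset.antisymm (fun x hx => mem_disjCompl_disjCompl_of_coe hx) ?_
  have hB := h _ (isBand_disjCompl (disjCompl ((fun y : E => (y : F)) '' G)))
  refine Set.Subset.trans ?_ (hB.disjCompl_disjCompl_subset hE)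
  refine disjCompl_antitone (disjCompl_antitone fun g hg => ?_)
  exact subset_disjCompl_disjCompl _ ⟨g, hg, rfl⟩

/-- The elements dominated by some element of a given sublattice form an ideal, so a majorizing
sublattice dominates every element. -/
theorem IsMajorizing.exists_abs_le [PosSMulMono ℝ F] {H : VectorSublattice F}
    (hH : IsMajorizing (H : Set F)) (f : F) : ∃ h ∈ H, |f| ≤ h := by
  refine hH (ofSolid
    { carrier := {x | ∃ h ∈ H, |x| ≤ h}
      add_mem' := ?_
      zero_mem' := ⟨0, zero_mem H, by simp⟩
      smul_mem' := ?_ } ?_) (isIdeal_ofSolid _ _) ?_ f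
  · rintro x y ⟨a, ha, hxa⟩ ⟨b, hb, hyb⟩
    exact ⟨a + b, add_mem ha hb, (abs_add_le x y).trans (add_le_add hxa hyb)⟩
  · rintro c x ⟨a, ha, hxa⟩
    exact ⟨|c| • a, SMulMemClass.smul_mem _ ha,
      (abs_smul_le c x).trans (smul_le_smul_of_nonneg_left hxa (abs_nonneg c))⟩
  · rintro x y hxy ⟨a, ha, hya⟩
    exact ⟨a, ha, hxy.trans hya⟩
  · exact fun h hh => ⟨|h|, H.abs_mem hh, le_rfl⟩

theorem HasRegularDenseMajorizing.isRegular [PosSMulMono ℝ F] {E : VectorSublattice F}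
    (hE : IsArchimedeanVL E) (h : E.HasRegularDenseMajorizing) : E.IsRegular := by
  obtain ⟨H, hHE, hdense, hmaj, hreg⟩ := h
  rw [isRegular_iff] at hreg ⊢
  intro D hne hD v hv hvD
  -- The elements of `H` above some element of `D` still have infimum `0` in `H`.
  refine hreg {k : H | ∃ d ∈ D, (d : F) ≤ k} ?_ ⟨?_, fun z hz => ?_⟩ v hv ?_
  · obtain ⟨d, hd⟩ := hne
    obtain ⟨k, hk, hdk⟩ := IsMajorizing.exists_abs_le hmaj d
    exact ⟨⟨k, hk⟩, d, hd, (le_abs_self d).trans hdk⟩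
  · rintro k ⟨d, hd, hdk⟩
    exact le_trans (b := (d : F)) (hD.1 hd) hdk
  · refine hD.2 (show (⟨(z : F), hHE z z.2⟩ : E) ∈ lowerBounds D from fun d hd => ?_)
    obtain ⟨k, hk, hdk⟩ := IsMajorizing.exists_abs_le hmaj d
    have hdk' : d ≤ k := (le_abs_self d).trans hdk
    -- As `k - d` is a supremum of elements of `H`, `d` is an infimum of elements of `H`.
    have hlub := isLUB_of_order_dense_below hE (H := H.inside E) (sub_nonneg.2 hdk')
      fun w hw _ => hdense w hw
    have hle : k - d ≤ k - ⟨(z : F), hHE z z.2⟩ := hlub.2 fun l hl => by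
      have hzl : (z : F) ≤ (k : F) - l :=
        mem_lowerBounds.1 hz ⟨(k : F) - l, sub_mem hk hl.1⟩ ⟨d, hd, le_sub_comm.1 hl.2.2⟩
      exact le_sub_comm.1 (show (⟨(z : F), hHE z z.2⟩ : E) ≤ k - l from hzl)
    exact (sub_le_sub_iff_left k).1 hle
  · rintro k ⟨d, hd, hdk⟩
    exact (hvD d hd).trans hdk

theorem isRegular_of_doubleComplAgrees [PosSMulMono ℝ F] {E : VectorSublattice F}
    (hF : IsArchimedeanVL F) (h : ∀ G : Set E, E.DoubleComplAgrees G) : E.IsRegular := by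
  rw [isRegular_iff]
  rintro D ⟨d₀, hd₀⟩ hD v hv hvD
  have hd₀0 : 0 ≤ d₀ := hD.1 hd₀
  refine eq_zero_of_forall_le_smul hF hv (x := (d₀ : F)) hd₀0 fun n => ?_
  have hpos : (0 : ℝ) < (n : ℝ) + 1 := by positivity
  set e : E := (1 / ((n : ℝ) + 1)) • d₀ with he
  have he0 : 0 ≤ e := smul_nonneg (one_div_pos.2 hpos).le hd₀0
  set G : Set E := (fun d => (e - d)⁺) '' D
  have heE : e ∈ disjCompl (disjCompl G) := by
    intro f hf
    rw [abs_of_nonneg he0, inf_comm]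
    refine le_antisymm (hD.2 fun d hd => ?_) (le_inf (abs_nonneg f) he0)
    have hfd : |f| ⊓ (e - d)⁺ = 0 := by
      have := hf _ ⟨d, hd, rfl⟩
      rwa [abs_of_nonneg (posPart_nonneg _)] at this
    calc |f| ⊓ e ≤ |f| ⊓ ((e - d)⁺ + d) :=
          inf_le_inf_left _ (sub_le_iff_le_add.1 (le_posPart _))
      _ ≤ |f| ⊓ (e - d)⁺ + |f| ⊓ d :=
          inf_add_le_inf_add_inf (abs_nonneg f) (posPart_nonneg _) (hD.1 hd)
      _ ≤ d := by rw [hfd, zero_add]; exact inf_le_right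
  have heF : (e : F) ∈ disjCompl (disjCompl ((fun y : E => (y : F)) '' G)) :=
    (h G).symm.subset heE
  have hdF : (d₀ : F) ∈ disjCompl (disjCompl ((fun y : E => (y : F)) '' G)) := by
    have h1 := smul_mem_disjCompl ((n : ℝ) + 1) heF
    have h2 : ((n : ℝ) + 1) • (e : F) = d₀ := by
      show ((n : ℝ) + 1) • ((1 / ((n : ℝ) + 1)) • (d₀ : F)) = d₀
      rw [smul_smul, mul_one_div_cancel hpos.ne', one_smul]
    rwa [h2] at h1
  have hvG : (v - e)⁺ ∈ disjCompl ((fun y : E => (y : F)) '' G) := by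
    rintro _ ⟨_, ⟨d, hd, rfl⟩, rfl⟩
    have hpn : ((e : F) - d)⁻ ⊓ ((e : F) - d)⁺ = 0 := by
      rw [inf_comm]; exact posPart_inf_negPart_eq_zero _
    show |(v - e)⁺| ⊓ |((e : F) - d)⁺| = 0
    rw [abs_of_nonneg (posPart_nonneg _), abs_of_nonneg (posPart_nonneg _)]
    refine inf_eq_zero_of_le_of_le (posPart_nonneg _) (posPart_nonneg _) ?_ le_rfl hpn
    rw [negPart_def, neg_sub]
    exact posPart_mono (sub_le_sub_right (hvD d hd) _)
  have hle : (v - e)⁺ ≤ (d₀ : F) :=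
    sup_le ((sub_le_self v (show (0 : F) ≤ e from he0)).trans (hvD d₀ hd₀)) hd₀0
  have h0 := hdF _ hvG
  rw [abs_of_nonneg (posPart_nonneg _), abs_of_nonneg (show (0 : F) ≤ d₀ from hd₀0),
    inf_eq_right.2 hle] at h0
  exact sub_nonpos.1 (posPart_eq_zero.1 h0)

end VectorSublattice

open VectorSublattice in
theorem corollary3p8 {F : Type*} [AddCommGroup F] [Lattice F] [IsOrderedAddMonoid F]
    [Module ℝ F] [PosSMulMono ℝ F] (E : VectorSublattice F) :
    -- `F` Archimedean: all the conditions are equivalent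
    (IsArchimedeanVL F →
      List.TFAE [
        E.IsRegular,
        E.RegularInIdeals,
        E.RegularInMajorizingIdeals,
        E.MeetsBandsInBands,
        ∀ G : Set E, E.DoubleComplAgrees G,
        ∀ G : VectorSublattice E, G.IsIdeal → E.DoubleComplAgrees (G : Set E),
        E.HasRegularDenseMajorizing]) ∧
    -- only `E` Archimedean
    (IsArchimedeanVL E →
      (E.IsRegular ↔ E.HasRegularDenseMajorizing) ∧
      (E.MeetsBandsInBands → ∀ G : Set E, E.DoubleComplAgrees G)) ∧
    -- arbitrary `F`
    List.TFAE [E.IsRegular, E.RegularInIdeals, E.RegularInMajorizingIdeals] ∧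
    (E.IsRegular → E.MeetsBandsInBands) ∧
    ((∀ G : Set E, E.DoubleComplAgrees G) ↔
      ∀ G : VectorSublattice E, G.IsIdeal → E.DoubleComplAgrees (G : Set E)) := by
  refine ⟨fun hF => ?_, fun hE => ⟨⟨IsRegular.hasRegularDenseMajorizing,
    HasRegularDenseMajorizing.isRegular hE⟩, MeetsBandsInBands.doubleComplAgrees hE⟩, ?_,
    IsRegular.meetsBandsInBands, fun h G _ => h G, doubleComplAgrees_of_isIdeal⟩
  · have hE := isArchimedeanVL_coe hF E
    tfae_have 1 → 2 := IsRegular.regularInIdeals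
    tfae_have 2 → 3 := RegularInIdeals.regularInMajorizingIdeals
    tfae_have 3 → 1 := RegularInMajorizingIdeals.isRegular
    tfae_have 1 → 4 := IsRegular.meetsBandsInBands
    tfae_have 4 → 5 := MeetsBandsInBands.doubleComplAgrees hE
    tfae_have 5 → 6 := fun h G _ => h G
    tfae_have 6 → 5 := doubleComplAgrees_of_isIdeal
    tfae_have 5 → 1 := isRegular_of_doubleComplAgrees hF
    tfae_have 1 → 7 := IsRegular.hasRegularDenseMajorizing
    tfae_have 7 → 1 := HasRegularDenseMajorizing.isRegular hE
    tfae_finish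
  · tfae_have 1 → 2 := IsRegular.regularInIdeals
    tfae_have 2 → 3 := RegularInIdeals.regularInMajorizingIdeals
    tfae_have 3 → 1 := RegularInMajorizingIdeals.isRegular
    tfae_finish
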